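/- For a positive integer $k$ write $[k]=\{1,\dots,k\}$. For $x\in\mathbb{R}^n$ let $\|x\|_1=\frac1n\sum_{i=1}^n|x_i|$. A function $f:[k]^n\to[l]^m$ is called $\alpha$-Lipschitz (with respect to the $L^1$-norm) if $\|f(x)-f(y)\|_1\le\alpha\|x-y\|_1$ for all $x,y\in[k]^n$. Two functions $u,v:[k]^n\to\mathbb{R}$ are called $\epsilon$-close if $\frac{1}{k^n}\sum_{x\in[k]^n}|u(x)-v(x)|\le\epsilon$. A function $g$ on $[k]^n$ is called an $M$-junta if there is a set $J\subset[n]$ with $|J|=M$ such that $g(x)$ depends only on $(x_j)_{j\in J}$. There is an absolute constant $C_3>0$ such that the following holds. Let $k,l,n,m$ be positive integers, let $\alpha\in\mathbb{R}$, and suppose that $f=(f_1,\dots,f_m):[k]^n\to[l]^m$ is $\alpha$-Lipschitz with respect to the $L^1$-norm. Then for any $\delta,\epsilon>0$ there is a non-negative integer $$M\le (l-1)\exp\left(\frac{C_3\,\alpha k}{\delta\epsilon}\right)$$ such that for at least $(1-\delta)m$ coordinates $i\in[m]$ the function $f_i$ is $\epsilon$-close to some $M$-junta $g_i:[k]^n\to[l]$.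 Moreover, one can take $C_3=2C_1$ for any constant $C_1$ with the following property: for all positive integers $k,n$, all $A\subset[k]^n$ and all $\epsilon>0$, the characteristic function $1_A$ is $\epsilon$-close to some $M$-junta $g:[k]^n\to\{0,1\}$ with $M\le\exp\left(C_1|\partial A|/(k^{n-1}\epsilon)\right)$. Here $\partial A$ is the set of edges joining a point of $A$ to a point of $[k]^n\setminus A$ in the graph on $[k]^n$ in which two points are adjacent if and only if they differ in exactly one coordinate, and by exactly $1$ in that coordinate. -/

import Mathlib

namespace L1Grid

/-- The point of `{1, …, k}` labelled by `a : Fin k`, as a real number: `[k] = {1, …, k}` is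
modelled by `Fin k`, with `0, …, k - 1` standing for `1, …, k`. -/
def label {k : ℕ} (a : Fin k) : ℝ := ((a : ℕ) : ℝ) + 1

/-- The normalised `L¹`-distance `‖x - y‖₁ = (1/n) ∑ᵢ |xᵢ - yᵢ|` between `x, y ∈ [k]^n`. -/
noncomputable def dist₁ {k n : ℕ} (x y : Fin n → Fin k) : ℝ :=
  (1 / (n : ℝ)) * ∑ i, |label (x i) - label (y i)|

/-- `f : [k]^n → [l]^m` is `α`-Lipschitz with respect to the normalised `L¹`-norms. -/
def IsLipschitz {k l n m : ℕ} (α : ℝ) (f : (Fin n → Fin k) → (Fin m → Fin l)) : Prop :=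
  ∀ x y, dist₁ (f x) (f y) ≤ α * dist₁ x y

/-- The normalised `L¹`-norm `‖h‖₁ = k^{-n} ∑ₓ |h(x)|` of a real function on `[k]^n`. -/
noncomputable def norm₁ {k n : ℕ} (h : (Fin n → Fin k) → ℝ) : ℝ :=
  (1 / (k : ℝ) ^ n) * ∑ x, |h x|

/-- Two real functions on `[k]^n` are `ε`-close if `‖f - g‖₁ ≤ ε`. -/
def IsClose {k n : ℕ} (ε : ℝ) (f g : (Fin n → Fin k) → ℝ) : Prop :=
  norm₁ (fun x => f x - g x) ≤ ε

/-- `g` is an `M`-junta: for some set `J` of exactly `M` coordinates, `g x` depends only on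
`(x j)` for `j ∈ J`. -/
def IsJunta {k n : ℕ} {β : Type*} (M : ℕ) (g : (Fin n → Fin k) → β) : Prop :=
  ∃ J : Finset (Fin n), J.card = M ∧ DependsOn g (J : Set (Fin n))

/-- The `ℓ¹`-grid on `[k]^n`: adjacent points differ in exactly one coordinate, and there by
exactly `1`. -/
def grid (k n : ℕ) : SimpleGraph (Fin n → Fin k) where
  Adj x y := ∃ j, |label (y j) - label (x j)| = 1 ∧ ∀ i, i ≠ j → x i = y i
  symm := ⟨by
    rintro x y ⟨j, hj, h⟩
    exact ⟨j, by rw [abs_sub_comm]; exact hj, fun i hi => (h i hi).symm⟩⟩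
  loopless := ⟨by
    rintro x ⟨j, hj, -⟩
    simp at hj⟩

/-- The edge-boundary of `A ⊆ [k]^n`: the edges of the grid joining a point of `A` to a point of
the complement of `A`. -/
def edgeBoundary {k n : ℕ} (A : Set (Fin n → Fin k)) : Set (Sym2 (Fin n → Fin k)) :=
  {e | e ∈ (grid k n).edgeSet ∧ ∃ x ∈ A, ∃ y ∉ A, e = s(x, y)}

/-- `C` is an admissible constant in the junta theorem for the `ℓ¹`-grid: for every `A ⊆ [k]^n`
and every `ε > 0`, the function `1_A` is `ε`-close to some `{0,1}`-valued `M`-junta (written as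
the characteristic function of a set `B`) with `M ≤ exp (C |∂A| / (k^{n-1} ε))`. -/
def IsGridJuntaConstant (C : ℝ) : Prop :=
  ∀ k n : ℕ, 1 ≤ k → 1 ≤ n → ∀ (A : Set (Fin n → Fin k)) (ε : ℝ), 0 < ε →
    ∃ (M : ℕ) (B : Set (Fin n → Fin k)),
      IsJunta M (B.indicator (fun _ => (1 : ℝ))) ∧
      IsClose ε (A.indicator fun _ => (1 : ℝ)) (B.indicator fun _ => (1 : ℝ)) ∧
      (M : ℝ) ≤ Real.exp (C * ((edgeBoundary A).ncard : ℝ) / ((k : ℝ) ^ (n - 1) * ε))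

end L1Grid

/-! Each grid edge has normalised length `1 / n`, so the coordinate functions of a Lipschitz map
have total variation at most `α * k ^ n` on average (`IsLipschitz.sum_dirVar_le`). By Markov's
inequality all but at most `δ * m` of them have variation at most `α * k ^ n / δ`. By the coarea
formula the boundaries of the `l - 1` level sets of such a function add up to its variation. The
junta theorem for sets approximates every level set, and the sum of the approximating indicators is
the required junta (`exists_dependsOn_isClose`).

The junta theorem itself (`isGridJuntaConstant`) averages out all coordinates of small influence and
rounds the result. The error is controlled by the method of Falik and Samorodnitsky
(`mul_sq_sub_avgs_le`): a martingale difference with small `L¹`-norm either has small variance or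
has large squared entropy, and a logarithmic Sobolev inequality bounds that entropy by an energy. To
avoid a loss in `k`, the energy comes not from the nearest-neighbour form on the path but from a
form built by repeated bisection (`exists_logSobolev_form`), which on indicators costs at most `6`
times the total variation. -/

namespace L1Grid

open Finset Function
open scoped BigOperators

/-! ### Averaging over coordinates as conditional expectation -/

section Averaging

variable {ι κ : Type*} [Fintype ι] [DecidableEq ι] [Fintype κ] [Nonempty κ]

/-- Average of `f` over the `i`-th coordinate, for the uniform measure. -/
noncomputable def avg (i : ι) (f : (ι → κ) → ℝ) (x : ι → κ) : ℝ := 𝔼 a, f (update x i a)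

/-- Successive averages over the coordinates in a list. -/
noncomputable def avgs : List ι → ((ι → κ) → ℝ) → ((ι → κ) → ℝ)
  | [], f => f
  | i :: l, f => avgs l (avg i f)

omit [Fintype ι] [Nonempty κ] in
lemma avg_sub (i : ι) (f g : (ι → κ) → ℝ) :
    avg i (fun x => f x - g x) = fun x => avg i f x - avg i g x := by
  funext x; simp [avg, expect_sub_distrib]

omit [Fintype ι] [Nonempty κ] in
lemma avg_comm (i j : ι) (f : (ι → κ) → ℝ) : avg i (avg j f) = avg j (avg i f) := by
  rcases eq_or_ne i j with rfl | h
  · rfl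
  · funext x
    simp only [avg]
    rw [expect_comm]
    simp only [update_comm h]

omit [Fintype ι] [Nonempty κ] in
lemma avg_update (i : ι) (f : (ι → κ) → ℝ) (x : ι → κ) (a : κ) :
    avg i f (update x i a) = avg i f x := by simp [avg]

omit [Fintype ι] in
lemma avg_eq_self {i : ι} {f : (ι → κ) → ℝ} (h : ∀ x a, f (update x i a) = f x) :
    avg i f = f := by
  funext x; simp [avg, h]

omit [Fintype ι] in
lemma avg_update_of_invariant {j : ι} {f : (ι → κ) → ℝ} (h : ∀ x a, f (update x j a) = f x)
    (i : ι) (x : ι → κ) (a : κ) : avg i f (update x j a) = avg i f x := by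
  rw [← avg_eq_self h, avg_comm, avg_update]

omit [Fintype ι] [Nonempty κ] in
lemma avg_mul_of_invariant {i : ι} {u : (ι → κ) → ℝ} (h : ∀ x a, u (update x i a) = u x)
    (f : (ι → κ) → ℝ) : avg i (fun x => f x * u x) = fun x => avg i f x * u x := by
  funext x; simp [avg, h, expect_mul]

omit [Fintype ι] [Nonempty κ] in
lemma avg_nonneg {i : ι} {f : (ι → κ) → ℝ} (h : ∀ x, 0 ≤ f x) (x : ι → κ) : 0 ≤ avg i f x :=
  expect_nonneg fun _ _ => h _

omit [Fintype ι] [Nonempty κ] in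
lemma avg_pos {i : ι} {f : (ι → κ) → ℝ} (h : ∀ x, 0 ≤ f x) {x : ι → κ} (hx : 0 < f x) :
    0 < avg i f x :=
  expect_pos' (fun _ _ => h _) ⟨x i, mem_univ _, by simpa using hx⟩

omit [Fintype ι] [Nonempty κ] in
lemma abs_avg_le (i : ι) (f : (ι → κ) → ℝ) (x : ι → κ) :
    |avg i f x| ≤ avg i (fun y => |f y|) x := abs_expect_le _ _

lemma expect_avg (i : ι) (f : (ι → κ) → ℝ) : 𝔼 x, avg i f x = 𝔼 x, f x := by
  -- Exchanging `x i` with the fresh sample `a` is an involution preserving the uniform measure.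
  let e : (ι → κ) × κ ≃ (ι → κ) × κ :=
    { toFun := fun p => (update p.1 i p.2, p.1 i)
      invFun := fun p => (update p.1 i p.2, p.1 i)
      left_inv := fun p => by simp
      right_inv := fun p => by simp }
  calc 𝔼 x, avg i f x = 𝔼 p : (ι → κ) × κ, f (update p.1 i p.2) := by
        rw [← univ_product_univ, expect_product]; rfl
    _ = 𝔼 p : (ι → κ) × κ, f p.1 := Fintype.expect_equiv e _ _ fun _ => rfl
    _ = 𝔼 x, f x := by
        rw [← univ_product_univ, expect_product]; simp

lemma expect_avg_mul (i : ι) (f : (ι → κ) → ℝ) {u : (ι → κ) → ℝ}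
    (h : ∀ x a, u (update x i a) = u x) : 𝔼 x, avg i f x * u x = 𝔼 x, f x * u x := by
  rw [← expect_avg i (fun x => f x * u x), avg_mul_of_invariant h]

lemma expect_sq_split (i : ι) (f : (ι → κ) → ℝ) :
    𝔼 x, avg i f x ^ 2 + 𝔼 x, (f x - avg i f x) ^ 2 = 𝔼 x, f x ^ 2 := by
  have h := expect_avg_mul i f (avg_update i f)
  have h2 : 𝔼 x, (f x - avg i f x) ^ 2
      = 𝔼 x, f x ^ 2 - 2 * 𝔼 x, f x * avg i f x + 𝔼 x, avg i f x * avg i f x := by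
    rw [mul_expect, ← expect_sub_distrib, ← expect_add_distrib]
    exact expect_congr rfl fun x _ => by ring
  simp only [← pow_two] at h h2
  rw [h2, ← h]; ring

lemma expect_avgs (l : List ι) (f : (ι → κ) → ℝ) : 𝔼 x, avgs l f x = 𝔼 x, f x := by
  induction l generalizing f with
  | nil => rfl
  | cons i l ih => rw [avgs, ih, expect_avg]

omit [Fintype ι] in
lemma avgs_update_of_invariant {j : ι} (l : List ι) {f : (ι → κ) → ℝ}
    (h : ∀ x a, f (update x j a) = f x) (x : ι → κ) (a : κ) :
    avgs l f (update x j a) = avgs l f x := by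
  induction l generalizing f with
  | nil => exact h x a
  | cons i l ih => exact ih (avg_update_of_invariant h i)

omit [Fintype ι] in
lemma avgs_update {l : List ι} {i : ι} (hi : i ∈ l) (f : (ι → κ) → ℝ) (x : ι → κ) (a : κ) :
    avgs l f (update x i a) = avgs l f x := by
  induction l generalizing f with
  | nil => simp at hi
  | cons j l ih =>
    by_cases h : i ∈ l
    · exact ih h _
    · obtain rfl : i = j := by simpa [h] using hi
      exact avgs_update_of_invariant l (avg_update i f) x a

omit [Fintype κ] [Nonempty κ] in
lemma dependsOn_of_update {J : Finset ι} {f : (ι → κ) → ℝ}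
    (h : ∀ i ∉ J, ∀ x a, f (update x i a) = f x) : DependsOn f (J : Set ι) := by
  intro x y hxy
  -- Pass from `x` to `y` by changing one coordinate outside `J` at a time.
  have key : ∀ s : Finset ι, (∀ i ∈ s, i ∉ J) →
      f (fun i => if i ∈ s then y i else x i) = f x := by
    intro s
    induction s using Finset.induction_on with
    | empty => intro _; simp
    | insert i s his ih =>
      intro hs
      rw [← ih fun j hj => hs j (mem_insert_of_mem hj),
        ← h i (hs i (mem_insert_self _ _)) (fun j => if j ∈ s then y j else x j) (y i)]
      congr 1
      funext j
      by_cases hj : j = i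
      · subst hj; simp
      · simp [hj]
  rw [← key (univ \ J) (by simp)]
  congr 1
  funext i
  by_cases hi : i ∈ J
  · simp [hi, hxy i hi]
  · simp [hi]

lemma expect_mul_avgs (l : List ι) (f u : (ι → κ) → ℝ)
    (hu : ∀ i ∈ l, ∀ x a, u (update x i a) = u x) :
    𝔼 x, avgs l f x * u x = 𝔼 x, f x * u x := by
  induction l generalizing f with
  | nil => rfl
  | cons i l ih =>
    rw [avgs, ih _ fun j hj => hu j (by simp [hj]), expect_avg_mul i f (hu i (by simp))]

lemma expect_sub_avgs_sq (l : List ι) (f : (ι → κ) → ℝ) :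
    𝔼 x, (f x - avgs l f x) ^ 2 = 𝔼 x, f x ^ 2 - 𝔼 x, avgs l f x ^ 2 := by
  have h := expect_mul_avgs l f (avgs l f) fun i hi => avgs_update hi f
  have h2 : 𝔼 x, (f x - avgs l f x) ^ 2
      = 𝔼 x, f x ^ 2 - 2 * 𝔼 x, f x * avgs l f x + 𝔼 x, avgs l f x * avgs l f x := by
    rw [mul_expect, ← expect_sub_distrib, ← expect_add_distrib]
    exact expect_congr rfl fun x _ => by ring
  simp only [← pow_two] at h h2
  rw [h2, ← h]; ring

lemma avgs_univ (f : (ι → κ) → ℝ) (x : ι → κ) : avgs univ.toList f x = 𝔼 y, f y := by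
  have h : ∀ y, avgs univ.toList f y = avgs univ.toList f x := fun y =>
    dependsOn_of_update (J := ∅) (fun i _ => avgs_update (by simp) f) (by simp)
  rw [← expect_avgs univ.toList f]
  simp [h]

end Averaging

/-! ### Entropy on product spaces -/

section Entropy

variable {ι κ : Type*} [Fintype ι] [DecidableEq ι] [Fintype κ] [Nonempty κ]

/-- The function `t log t`. -/
noncomputable def xlogx (t : ℝ) : ℝ := t * Real.log t

/-- The mean entropy of `h` along the `i`-th coordinate. -/
noncomputable def condEnt (i : ι) (h : (ι → κ) → ℝ) : ℝ :=
  𝔼 x, xlogx (h x) - 𝔼 x, xlogx (avg i h x)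

/-- Convexity of relative entropy in disguise. Invariance under averaging lets all four terms be
written as means of `h` times a logarithm; then `log t ≤ t - 1` finishes, because the ratio `avg i h
/ avg i u` does not depend on coordinate `i`. -/
lemma condEnt_avg_le (i j : ι) {h : (ι → κ) → ℝ} (h0 : ∀ x, 0 ≤ h x) :
    condEnt i (avg j h) ≤ condEnt i h := by
  set u := avg j h with hu
  have u0 : ∀ x, 0 ≤ u x := avg_nonneg h0
  have e1 : 𝔼 x, xlogx (avg i h x) = 𝔼 x, h x * Real.log (avg i h x) :=
    expect_avg_mul i h fun x a => by rw [avg_update]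
  have e2 : 𝔼 x, xlogx (u x) = 𝔼 x, h x * Real.log (u x) :=
    expect_avg_mul j h fun x a => by rw [hu, avg_update]
  have e3 : 𝔼 x, xlogx (avg i u x) = 𝔼 x, h x * Real.log (avg i u x) := by
    have hc : avg i u = avg j (avg i h) := avg_comm i j h
    rw [show (𝔼 x, xlogx (avg i u x)) = 𝔼 x, u x * Real.log (avg i u x) from
      expect_avg_mul i u fun x a => by rw [avg_update]]
    exact expect_avg_mul j h fun x a => by rw [hc, avg_update]
  have hpt : ∀ x, h x - u x * (avg i h x / avg i u x) ≤
      h x * Real.log (h x) - h x * Real.log (avg i h x)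
        - (h x * Real.log (u x) - h x * Real.log (avg i u x)) := by
    intro x
    rcases (h0 x).eq_or_lt with hx | hx
    · rw [← hx]
      have := mul_nonneg (u0 x) (div_nonneg (avg_nonneg (i := i) h0 x) (avg_nonneg (i := i) u0 x))
      linarith
    · have ux : 0 < u x := avg_pos h0 hx
      have a1 : 0 < avg i h x := avg_pos h0 hx
      have a2 : 0 < avg i u x := avg_pos u0 ux
      have hl := Real.log_le_sub_one_of_pos
        (show 0 < u x * avg i h x / (avg i u x * h x) by positivity)
      rw [Real.log_div (by positivity) (by positivity), Real.log_mul ux.ne' a1.ne',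
        Real.log_mul a2.ne' hx.ne'] at hl
      have := mul_le_mul_of_nonneg_left hl hx.le
      have e : h x * (u x * avg i h x / (avg i u x * h x) - 1)
          = u x * (avg i h x / avg i u x) - h x := by field_simp
      rw [e] at this
      linarith
  have h1 : 𝔼 x, u x * (avg i h x / avg i u x) ≤ 𝔼 x, h x := by
    rw [← expect_avg_mul i u (u := fun x => avg i h x / avg i u x)
      (fun x a => by rw [avg_update, avg_update]), ← expect_avg i h]
    refine expect_le_expect fun x _ => ?_
    rw [mul_div_left_comm]
    exact mul_le_of_le_one_right (avg_nonneg h0 x) (div_self_le_one _)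
  have h2 := expect_le_expect (s := univ) fun x _ => hpt x
  simp only [expect_sub_distrib] at h2
  have e4 : 𝔼 x, xlogx (h x) = 𝔼 x, h x * Real.log (h x) := rfl
  rw [condEnt, condEnt, e1, e2, e3, e4]
  linarith

/-- The entropy telescopes along the list, and earlier averages only decrease the later
one-coordinate entropies. -/
lemma ent_avgs_le (l : List ι) {h : (ι → κ) → ℝ} (h0 : ∀ x, 0 ≤ h x) :
    𝔼 x, xlogx (h x) - 𝔼 x, xlogx (avgs l h x) ≤ (l.map fun i => condEnt i h).sum := by
  induction l generalizing h with
  | nil => simp [avgs]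
  | cons i l ih =>
    have h1 := ih (avg_nonneg (i := i) h0)
    have h2 : (l.map fun j => condEnt j (avg i h)).sum ≤ (l.map fun j => condEnt j h).sum :=
      List.sum_le_sum fun j _ => condEnt_avg_le j i h0
    simp only [List.map_cons, List.sum_cons, avgs]
    have : condEnt i h = 𝔼 x, xlogx (h x) - 𝔼 x, xlogx (avg i h x) := rfl
    linarith

/-- Subadditivity of entropy on a product space. -/
lemma ent_le_sum_condEnt {h : (ι → κ) → ℝ} (h0 : ∀ x, 0 ≤ h x) :
    𝔼 x, xlogx (h x) - xlogx (𝔼 x, h x) ≤ ∑ i, condEnt i h := by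
  have := ent_avgs_le univ.toList h0
  simpa [avgs_univ, sum_map_toList] using this

/-- Lower bound for the entropy of a square in terms of its first two moments. -/
lemma mul_sq_sub_le_ent {Ω : Type*} [Fintype Ω] [Nonempty Ω] (d : Ω → ℝ) (L : ℝ) :
    L * 𝔼 x, d x ^ 2 - Real.exp L * (𝔼 x, |d x|) ^ 2
      ≤ 𝔼 x, xlogx (d x ^ 2) - xlogx (𝔼 x, d x ^ 2) := by
  set v := 𝔼 x, d x ^ 2 with hv
  set w := 𝔼 x, |d x| with hw
  by_cases hd : ∀ x, d x = 0
  · simp [hv, hw, hd, xlogx]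
  push Not at hd
  obtain ⟨y, hy⟩ := hd
  have v0 : 0 < v := expect_pos' (fun _ _ => sq_nonneg _) ⟨y, mem_univ _, by positivity⟩
  have w0 : 0 < w := expect_pos' (fun _ _ => abs_nonneg _) ⟨y, mem_univ _, by positivity⟩
  -- The left side has mean zero, so averaging gives entropy at least `v * log (v / w ^ 2)`.
  have hpt : ∀ x, 2 * (d x ^ 2 - |d x| * (v / w)) ≤
      xlogx (d x ^ 2) - d x ^ 2 * (2 * (Real.log v - Real.log w)) := by
    intro x
    by_cases hx : d x = 0
    · simp [hx, xlogx]
    have hx' : 0 < |d x| := abs_pos.2 hx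
    have hl := Real.log_le_sub_one_of_pos (show 0 < v / (|d x| * w) by positivity)
    rw [Real.log_div v0.ne' (by positivity), Real.log_mul hx'.ne' w0.ne'] at hl
    have := mul_le_mul_of_nonneg_left hl (sq_nonneg |d x|)
    have e : |d x| ^ 2 * (v / (|d x| * w) - 1) = |d x| * (v / w) - |d x| ^ 2 := by field_simp
    rw [e] at this
    rw [xlogx, Real.log_pow, ← Real.log_abs (d x), ← sq_abs]
    push_cast
    linarith
  have h1 := expect_le_expect (s := univ) fun x _ => hpt x
  rw [← mul_expect, expect_sub_distrib, expect_sub_distrib, ← expect_mul, ← expect_mul, ← hv,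
    ← hw, mul_div_cancel₀ _ w0.ne', sub_self, mul_zero] at h1
  -- This linearises `v * log (v / w ^ 2)` from below with the free parameter `L`.
  have hl := Real.log_le_sub_one_of_pos (show 0 < Real.exp L * w ^ 2 / v by positivity)
  rw [Real.log_div (by positivity) v0.ne', Real.log_mul (by positivity) (by positivity),
    Real.log_exp, Real.log_pow] at hl
  have h2 := mul_le_mul_of_nonneg_left hl v0.le
  have e : v * (Real.exp L * w ^ 2 / v - 1) = Real.exp L * w ^ 2 - v := by field_simp
  rw [e] at h2
  push_cast at h2
  simp only [xlogx] at h1 ⊢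
  linarith

end Entropy

/-! ### Energies and the Falik–Samorodnitsky inequality -/

section Energy

variable {ι κ τ : Type*} [Fintype ι] [DecidableEq ι] [Fintype κ] [Nonempty κ] [Fintype τ]

/-- The energy on `ι → κ` obtained from the quadratic form
`g ↦ ∑ e, w e * (g (a e) - g (b e)) ^ 2` on functions on `κ`. -/
noncomputable def energy (w : τ → ℝ) (a b : τ → κ) (f : (ι → κ) → ℝ) : ℝ :=
  ∑ i, 𝔼 x, ∑ e, w e * (f (update x i (a e)) - f (update x i (b e))) ^ 2

/-- In direction `i` the average contributes nothing. In any other direction differences commute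
with `avg i`, and Pythagoras applies. Hence the energies of successive martingale differences sum to
at most the energy of `f`. -/
lemma energy_avg_add_le {w : τ → ℝ} (hw : ∀ e, 0 ≤ w e) (a b : τ → κ) (i : ι)
    (f : (ι → κ) → ℝ) :
    energy w a b (avg i f) + energy w a b (fun x => f x - avg i f x) ≤ energy w a b f := by
  rw [energy, energy, energy, ← sum_add_distrib]
  refine sum_le_sum fun j _ => ?_
  simp only [expect_sum_comm, ← mul_expect]
  rw [← sum_add_distrib]
  refine sum_le_sum fun e _ => ?_
  rw [← mul_add]
  refine mul_le_mul_of_nonneg_left ?_ (hw e)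
  rcases eq_or_ne i j with rfl | hij
  · simp [avg_update]
  · have hD : avg i (fun x => f (update x j (a e)) - f (update x j (b e)))
        = fun x => avg i f (update x j (a e)) - avg i f (update x j (b e)) := by
      funext x
      simp only [avg, expect_sub_distrib, update_comm hij]
    have := expect_sq_split i (fun x => f (update x j (a e)) - f (update x j (b e)))
    rw [hD] at this
    rw [← this]
    refine le_of_eq ?_
    congr 1
    exact expect_congr rfl fun x _ => by ring

omit [Nonempty κ] in
lemma energy_nonneg {w : τ → ℝ} (hw : ∀ e, 0 ≤ w e) (a b : τ → κ) (f : (ι → κ) → ℝ) :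
    0 ≤ energy w a b f :=
  sum_nonneg fun _ _ => expect_nonneg fun _ _ => sum_nonneg fun e _ =>
    mul_nonneg (hw e) (sq_nonneg _)

/-- The logarithmic Sobolev inequality tensorises. -/
lemma ent_sq_le_energy {w : τ → ℝ} {a b : τ → κ}
    (hLS : ∀ g : κ → ℝ, 𝔼 t, xlogx (g t ^ 2) - xlogx (𝔼 t, g t ^ 2)
      ≤ ∑ e, w e * (g (a e) - g (b e)) ^ 2) (d : (ι → κ) → ℝ) :
    𝔼 x, xlogx (d x ^ 2) - xlogx (𝔼 x, d x ^ 2) ≤ energy w a b d := by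
  refine (ent_le_sum_condEnt fun x => sq_nonneg (d x)).trans (sum_le_sum fun i _ => ?_)
  rw [condEnt, ← expect_avg i (fun x => xlogx (d x ^ 2)), ← expect_sub_distrib]
  exact expect_le_expect fun x _ => hLS fun t => d (update x i t)

/-- The inequality of Falik and Samorodnitsky, for a list of coordinates. -/
lemma mul_sq_sub_avgs_le {w : τ → ℝ} (hw : ∀ e, 0 ≤ w e) {a b : τ → κ}
    (hLS : ∀ g : κ → ℝ, 𝔼 t, xlogx (g t ^ 2) - xlogx (𝔼 t, g t ^ 2)
      ≤ ∑ e, w e * (g (a e) - g (b e)) ^ 2)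
    (L : ℝ) (v : ι → ℝ) (l : List ι) (f : (ι → κ) → ℝ)
    (hv : ∀ i ∈ l, 𝔼 x, |f x - avg i f x| ≤ v i) :
    L * (𝔼 x, f x ^ 2 - 𝔼 x, avgs l f x ^ 2) ≤
      energy w a b f + Real.exp L * (l.map fun i => v i ^ 2).sum := by
  induction l generalizing f with
  | nil => simpa [avgs] using energy_nonneg hw a b f
  | cons i l ih =>
    -- The `L¹`-bounds survive the passage to `avg i f`, since averages commute and contract the
    -- `L¹`-norm.
    have h1 := ih (avg i f) fun j hj => by
      refine le_trans ?_ (hv j (by simp [hj]))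
      rw [← expect_avg i fun x => |f x - avg j f x|]
      refine expect_le_expect fun x _ => ?_
      refine le_trans (le_of_eq ?_) (abs_avg_le i _ x)
      rw [avg_sub, avg_comm i j]
    have h2 := energy_avg_add_le hw a b i f
    have h3 := ent_sq_le_energy hLS fun x => f x - avg i f x
    have h4 := mul_sq_sub_le_ent (fun x => f x - avg i f x) L
    have h5 := expect_sq_split i f
    have h6 : (𝔼 x, |f x - avg i f x|) ^ 2 ≤ v i ^ 2 :=
      pow_le_pow_left₀ (expect_nonneg fun _ _ => abs_nonneg _) (hv i (by simp)) 2
    have h7 := mul_le_mul_of_nonneg_left h6 (Real.exp_pos L).le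
    simp only [avgs, List.map_cons, List.sum_cons]
    rw [← h5]
    linarith

end Energy

/-! ### A logarithmic Sobolev form on the path, uniform in its length -/

section Interval

/-- Entropy of a function on a two-point space, bounded by its relative variance. -/
lemma two_point_ent_le {α β x y : ℝ} (hα : 0 < α) (hβ : 0 < β) (hαβ : α + β = 1) (hx : 0 ≤ x)
    (hy : 0 ≤ y) : α * xlogx x + β * xlogx y - xlogx (α * x + β * y)
      ≤ α * β * (x - y) ^ 2 / (α * x + β * y) := by
  set m := α * x + β * y with hm
  have m0 : 0 ≤ m := by positivity
  rcases m0.eq_or_lt with h | h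
  · have h1 : α * x = 0 := by nlinarith [mul_nonneg hα.le hx, mul_nonneg hβ.le hy]
    have h2 : β * y = 0 := by nlinarith [mul_nonneg hα.le hx, mul_nonneg hβ.le hy]
    simp [xlogx, ← h, (mul_eq_zero.1 h1).resolve_left hα.ne',
      (mul_eq_zero.1 h2).resolve_left hβ.ne']
  · have key : ∀ t : ℝ, 0 ≤ t → xlogx t ≤ t * Real.log m + t * (t / m - 1) := by
      intro t ht
      rcases ht.eq_or_lt with rfl | ht'
      · simp [xlogx]
      · have := mul_le_mul_of_nonneg_left
          (Real.log_le_sub_one_of_pos (show 0 < t / m by positivity)) ht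
        rw [Real.log_div ht'.ne' h.ne'] at this
        rw [xlogx]
        linarith
    have h1 := mul_le_mul_of_nonneg_left (key x hx) hα.le
    have h2 := mul_le_mul_of_nonneg_left (key y hy) hβ.le
    have e : α * β * (x - y) ^ 2 / m = α * (x * (x / m - 1)) + β * (y * (y / m - 1)) := by
      field_simp
      rw [hm]
      obtain rfl : β = 1 - α := by linarith
      ring
    rw [e]
    have : xlogx m = α * (x * Real.log m) + β * (y * Real.log m) := by
      rw [xlogx]; nth_rewrite 1 [hm]; ring
    linarith

/-- The difference of the second moments of two samples is controlled by their mean squared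
distance. -/
lemma sq_sub_expect_sq_le {σ τ : Type*} [Fintype σ] [Fintype τ] [Nonempty σ] [Nonempty τ]
    (u : σ → ℝ) (v : τ → ℝ) :
    (𝔼 s, u s ^ 2 - 𝔼 t, v t ^ 2) ^ 2 ≤
      (𝔼 s, 𝔼 t, (u s - v t) ^ 2) * (2 * (𝔼 s, u s ^ 2 + 𝔼 t, v t ^ 2)) := by
  have h1 : 𝔼 s, u s ^ 2 - 𝔼 t, v t ^ 2 = 𝔼 p : σ × τ, (u p.1 - v p.2) * (u p.1 + v p.2) := by
    rw [← univ_product_univ, expect_product]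
    calc _ = 𝔼 s, 𝔼 t, (u s ^ 2 - v t ^ 2) := by simp [expect_sub_distrib]
      _ = _ := expect_congr rfl fun s _ => expect_congr rfl fun t _ => by ring
  have h2 : 𝔼 s, 𝔼 t, (u s - v t) ^ 2 = 𝔼 p : σ × τ, (u p.1 - v p.2) ^ 2 := by
    rw [← univ_product_univ, expect_product]
  have h3 : 𝔼 p : σ × τ, (u p.1 + v p.2) ^ 2 ≤ 2 * (𝔼 s, u s ^ 2 + 𝔼 t, v t ^ 2) := by
    calc _ ≤ 𝔼 p : σ × τ, 2 * (u p.1 ^ 2 + v p.2 ^ 2) :=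
          expect_le_expect fun p _ => by nlinarith [sq_nonneg (u p.1 - v p.2)]
      _ = _ := by
          rw [← univ_product_univ, expect_product]
          simp [← mul_expect, expect_add_distrib]
  rw [h1, h2]
  exact (expect_mul_sq_le_sq_mul_sq _ _ _).trans
    (mul_le_mul_of_nonneg_left h3 (expect_nonneg fun _ _ => sq_nonneg _))

lemma expect_fin_eq (p : ℕ) (g : ℕ → ℝ) : 𝔼 j : Fin p, g j = (∑ j ∈ range p, g j) / p := by
  rw [Fintype.expect_eq_sum_div_card, Fin.sum_univ_eq_sum_range, Fintype.card_fin]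

/-- Splitting an interval into two parts, neither of which is much longer than the other. -/
lemma exists_split {k : ℕ} (hk : 2 ≤ k) :
    ∃ p q : ℕ, 1 ≤ p ∧ 1 ≤ q ∧ p + q = k ∧ 3 * p ≤ 2 * k ∧ 3 * q ≤ 2 * k :=
  ⟨k / 2, k - k / 2, by omega, by omega, by omega, by omega, by omega⟩

lemma expect_fin_add {p q : ℕ} (hp : 1 ≤ p) (hq : 1 ≤ q) (g : ℕ → ℝ) :
    𝔼 j : Fin (p + q), g j = (p : ℝ) / (p + q : ℕ) * 𝔼 j : Fin p, g j
      + (q : ℝ) / (p + q : ℕ) * 𝔼 j : Fin q, g (p + j) := by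
  have hp' : (p : ℝ) ≠ 0 := by positivity
  have hq' : (q : ℝ) ≠ 0 := by positivity
  rw [expect_fin_eq, expect_fin_eq, expect_fin_eq q fun j => g (p + j), sum_range_add]
  field_simp

lemma abs_sub_le_sum_range (g : ℕ → ℝ) {K : ℕ} {s t : ℕ} (hs : s ≤ K) (ht : t ≤ K) :
    |g s - g t| ≤ ∑ j ∈ range K, |g (j + 1) - g j| := by
  wlog h : s ≤ t generalizing s t
  · rw [abs_sub_comm]; exact this ht hs (by omega)
  have e : g t - g s = ∑ j ∈ Ico s t, (g (j + 1) - g j) := (sum_Ico_sub g h).symm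
  rw [abs_sub_comm, e]
  refine (abs_sum_le_sum_abs _ _).trans
    (sum_le_sum_of_subset_of_nonneg (fun j hj => ?_) fun _ _ _ => abs_nonneg _)
  simp only [mem_Ico, mem_range] at hj ⊢
  omega

/-- A logarithmic Sobolev inequality on the path with `k` vertices, for a quadratic form which on
characteristic functions is bounded by the total variation, uniformly in `k`. -/
theorem exists_logSobolev_form (k : ℕ) (hk : 1 ≤ k) :
    ∃ (τ : Type) (_ : Fintype τ) (w : τ → ℝ) (a b : τ → ℕ), (∀ e, 0 ≤ w e) ∧
      (∀ g : ℕ → ℝ, 𝔼 j : Fin k, xlogx (g j ^ 2) - xlogx (𝔼 j : Fin k, g j ^ 2)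
        ≤ ∑ e, w e * (g (a e) - g (b e)) ^ 2) ∧
      ∀ g : ℕ → ℝ, (∀ j, g j = 0 ∨ g j = 1) →
        ∑ e, w e * (g (a e) - g (b e)) ^ 2 ≤ 6 * ∑ j ∈ range (k - 1), |g (j + 1) - g j| := by
  induction k using Nat.strong_induction_on with
  | _ k ih =>
  rcases hk.eq_or_lt with rfl | hk2
  · refine ⟨Empty, inferInstance, fun _ => 0, fun _ => 0, fun _ => 0, by simp, ?_, by simp⟩
    intro g
    simp
  obtain ⟨p, q, hp, hq, rfl, hp3, hq3⟩ := exists_split hk2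
  obtain ⟨τ₁, _, w₁, a₁, b₁, hw₁, hLS₁, hTV₁⟩ := ih p (by omega) hp
  obtain ⟨τ₂, _, w₂, a₂, b₂, hw₂, hLS₂, hTV₂⟩ := ih q (by omega) hq
  have : Nonempty (Fin p) := ⟨⟨0, hp⟩⟩
  have : Nonempty (Fin q) := ⟨⟨0, hq⟩⟩
  set α : ℝ := (p : ℝ) / (p + q : ℕ) with hα
  set β : ℝ := (q : ℝ) / (p + q : ℕ) with hβ
  have p0 : (0 : ℝ) < p := by exact_mod_cast hp
  have q0 : (0 : ℝ) < q := by exact_mod_cast hq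
  have α0 : 0 < α := by positivity
  have β0 : 0 < β := by positivity
  have hαβ : α + β = 1 := by rw [hα, hβ, ← add_div, ← Nat.cast_add, div_self (by positivity)]
  have hα3 : α ≤ 2 / 3 := by
    rw [hα, div_le_div_iff₀ (by positivity) (by norm_num)]
    exact_mod_cast (by linarith : p * 3 ≤ 2 * (p + q))
  have hβ3 : β ≤ 2 / 3 := by
    rw [hβ, div_le_div_iff₀ (by positivity) (by norm_num)]
    exact_mod_cast (by linarith : q * 3 ≤ 2 * (p + q))
  -- The form for `p + q` is the weighted sum of the forms for the two halves, plus twice the mean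
  -- squared difference across the cut.
  have hform : ∀ g : ℕ → ℝ,
      ∑ e : (τ₁ ⊕ τ₂) ⊕ (Fin p × Fin q),
        Sum.elim (Sum.elim (fun e => α * w₁ e) fun e => β * w₂ e) (fun _ => 2 / (p * q : ℝ)) e *
        (g (Sum.elim (Sum.elim a₁ fun e => p + a₂ e) (fun e => (e.1 : ℕ)) e) -
          g (Sum.elim (Sum.elim b₁ fun e => p + b₂ e) (fun e => p + (e.2 : ℕ)) e)) ^ 2
      = α * ∑ e, w₁ e * (g (a₁ e) - g (b₁ e)) ^ 2
        + β * ∑ e, w₂ e * (g (p + a₂ e) - g (p + b₂ e)) ^ 2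
        + 2 * 𝔼 s : Fin p, 𝔼 t : Fin q, (g s - g (p + t)) ^ 2 := by
    intro g
    simp only [Fintype.sum_sum_type, Sum.elim_inl, Sum.elim_inr, Fintype.sum_prod_type, mul_sum,
      Fintype.expect_eq_sum_div_card, Fintype.card_fin, mul_assoc, sum_div]
    congr 1
    refine sum_congr rfl fun s _ => sum_congr rfl fun t _ => ?_
    field_simp
  refine ⟨(τ₁ ⊕ τ₂) ⊕ (Fin p × Fin q), inferInstance,
    Sum.elim (Sum.elim (fun e => α * w₁ e) fun e => β * w₂ e) (fun _ => 2 / (p * q : ℝ)),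
    Sum.elim (Sum.elim a₁ fun e => p + a₂ e) (fun e => (e.1 : ℕ)),
    Sum.elim (Sum.elim b₁ fun e => p + b₂ e) (fun e => p + (e.2 : ℕ)), ?_, ?_, ?_⟩
  · rintro ((e | e) | e)
    · exact mul_nonneg α0.le (hw₁ e)
    · exact mul_nonneg β0.le (hw₂ e)
    · simp only [Sum.elim_inr]; positivity
  · intro g
    rw [hform, expect_fin_add hp hq fun j => xlogx (g j ^ 2),
      expect_fin_add hp hq fun j => g j ^ 2, ← hα, ← hβ]
    have h1 := mul_le_mul_of_nonneg_left (hLS₁ g) α0.le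
    have h2 := mul_le_mul_of_nonneg_left (hLS₂ fun j => g (p + j)) β0.le
    have hx : 0 ≤ 𝔼 j : Fin p, g j ^ 2 := expect_nonneg fun _ _ => sq_nonneg _
    have hy : 0 ≤ 𝔼 j : Fin q, g (p + j) ^ 2 := expect_nonneg fun _ _ => sq_nonneg _
    -- By the chain rule, what remains beyond the halves is the entropy of the two block means of `g
    -- ^ 2`; it is paid for by the cross term.
    have h3 := two_point_ent_le α0 β0 hαβ hx hy
    have h4 := sq_sub_expect_sq_le (fun s : Fin p => g s) fun t : Fin q => g (p + t)
    have hD : 0 ≤ 𝔼 s : Fin p, 𝔼 t : Fin q, (g s - g (p + t)) ^ 2 :=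
      expect_nonneg fun _ _ => expect_nonneg fun _ _ => sq_nonneg _
    set x := 𝔼 j : Fin p, g j ^ 2
    set y := 𝔼 j : Fin q, g (p + j) ^ 2
    set D := 𝔼 s : Fin p, 𝔼 t : Fin q, (g s - g (p + t)) ^ 2
    have h5 : α * β * (x - y) ^ 2 / (α * x + β * y) ≤ 2 * D := by
      refine div_le_of_le_mul₀ (by positivity) (by positivity) ?_
      have h6 : α * β * (x + y) ≤ α * x + β * y := by
        have : α * x * β ≤ α * x := mul_le_of_le_one_right (by positivity) (by linarith)
        have : β * y * α ≤ β * y := mul_le_of_le_one_right (by positivity) (by linarith)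
        linarith
      calc α * β * (x - y) ^ 2 ≤ α * β * (D * (2 * (x + y))) :=
            mul_le_mul_of_nonneg_left h4 (by positivity)
        _ = 2 * D * (α * β * (x + y)) := by ring
        _ ≤ _ := mul_le_mul_of_nonneg_left h6 (by positivity)
    linarith
  · intro g hg
    rw [hform]
    set V := ∑ j ∈ range (p + q - 1), |g (j + 1) - g j| with hV
    have hD : 𝔼 s : Fin p, 𝔼 t : Fin q, (g s - g (p + t)) ^ 2 ≤ V := by
      refine expect_le univ_nonempty fun s _ => expect_le univ_nonempty fun t _ => ?_
      have := abs_sub_le_sum_range g (K := p + q - 1) (s := s) (t := p + t) (by omega) (by omega)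
      refine le_trans ?_ this
      rcases hg s with h | h <;> rcases hg (p + t) with h' | h' <;> simp [h, h']
    -- The constant closes up: the halves use disjoint edges, so they cost at most `(2 / 3) * 6 *
    -- V`, and the cross term at most `2 * V`.
    have h1 := mul_le_mul hα3 (hTV₁ g hg)
      (sum_nonneg fun e _ => mul_nonneg (hw₁ e) (sq_nonneg _)) (by norm_num)
    have h2 := mul_le_mul hβ3 (hTV₂ (fun j => g (p + j)) fun j => hg _)
      (sum_nonneg fun e _ => mul_nonneg (hw₂ e) (sq_nonneg _)) (by norm_num)
    have hV' : ∑ j ∈ range (p - 1), |g (j + 1) - g j|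
        + ∑ j ∈ range (q - 1), |g (p + (j + 1)) - g (p + j)| ≤ V := by
      have e : p + q - 1 = p + (q - 1) := by omega
      rw [hV, e, sum_range_add]
      refine add_le_add (sum_le_sum_of_subset_of_nonneg ?_ fun _ _ _ => abs_nonneg _) le_rfl
      exact range_subset_range.2 (by omega)
    linarith

/-- The successor in the path `Fin k`, the last vertex being its own successor. -/
def up {k : ℕ} (a : Fin k) : Fin k := ⟨min (a + 1) (k - 1), by have := a.2; omega⟩

/-- Total variation of a function on the path `Fin k`. -/
noncomputable def pathVar {k : ℕ} (g : Fin k → ℝ) : ℝ := ∑ a, |g (up a) - g a|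

/-- Extension of a function on `Fin k` to `ℕ`, constant from the last vertex on. -/
def clamp {k : ℕ} (hk : 1 ≤ k) (j : ℕ) : Fin k := ⟨min j (k - 1), by omega⟩

lemma clamp_coe {k : ℕ} (hk : 1 ≤ k) (a : Fin k) : clamp hk a = a := by
  ext; simp only [clamp]; omega

lemma pathVar_eq {k : ℕ} (hk : 1 ≤ k) (g : Fin k → ℝ) :
    pathVar g = ∑ j ∈ range (k - 1), |g (clamp hk (j + 1)) - g (clamp hk j)| := by
  obtain ⟨K, rfl⟩ : ∃ K, k = K + 1 := ⟨k - 1, by omega⟩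
  have h : ∀ a : Fin (K + 1), |g (up a) - g a| = |g (clamp hk (a + 1)) - g (clamp hk a)| :=
    fun a => by rw [clamp_coe]; rfl
  rw [pathVar, sum_congr rfl fun a _ => h a,
    Fin.sum_univ_eq_sum_range (fun j => |g (clamp hk (j + 1)) - g (clamp hk j)|), sum_range_succ]
  have : clamp hk (K + 1) = clamp hk K := by ext; simp [clamp]
  simp [this]

lemma abs_sub_le_pathVar {k : ℕ} (g : Fin k → ℝ) (s t : Fin k) : |g s - g t| ≤ pathVar g := by
  have hk : 1 ≤ k := s.pos
  rw [pathVar_eq hk]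
  have := abs_sub_le_sum_range (fun j => g (clamp hk j)) (K := k - 1) (s := s) (t := t)
    (by omega) (by omega)
  simpa only [clamp_coe] using this

theorem exists_logSobolev_form_fin (k : ℕ) (hk : 1 ≤ k) :
    ∃ (τ : Type) (_ : Fintype τ) (w : τ → ℝ) (a b : τ → Fin k), (∀ e, 0 ≤ w e) ∧
      (∀ g : Fin k → ℝ, 𝔼 j, xlogx (g j ^ 2) - xlogx (𝔼 j, g j ^ 2)
        ≤ ∑ e, w e * (g (a e) - g (b e)) ^ 2) ∧
      ∀ g : Fin k → ℝ, (∀ j, g j = 0 ∨ g j = 1) →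
        ∑ e, w e * (g (a e) - g (b e)) ^ 2 ≤ 6 * pathVar g := by
  obtain ⟨τ, hτ, w, a, b, hw, hLS, hTV⟩ := exists_logSobolev_form k hk
  refine ⟨τ, hτ, w, fun e => clamp hk (a e), fun e => clamp hk (b e), hw, fun g => ?_,
    fun g hg => ?_⟩
  · simpa only [clamp_coe] using hLS fun j => g (clamp hk j)
  · rw [pathVar_eq hk]
    exact hTV (fun j => g (clamp hk j)) fun j => hg _

end Interval

/-! ### Edge-boundary and directional variation -/

section Boundary

variable {k n : ℕ}

/-- Total variation of `f` along the edges of the grid in direction `i`. -/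
noncomputable def dirVar (i : Fin n) (f : (Fin n → Fin k) → ℝ) : ℝ :=
  ∑ x, |f (update x i (up (x i))) - f x|

lemma dirVar_nonneg (i : Fin n) (f : (Fin n → Fin k) → ℝ) : 0 ≤ dirVar i f :=
  sum_nonneg fun _ _ => abs_nonneg _

lemma up_val_of_ne {a : Fin k} (h : up a ≠ a) : (up a : ℕ) = a + 1 := by
  have h' : (up a : ℕ) ≠ a := fun e => h (Fin.ext e)
  simp only [up] at h' ⊢
  omega

lemma up_eq_of_val {a b : Fin k} (h : (b : ℕ) = a + 1) : up a = b := by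
  ext; simp only [up]; omega

lemma abs_label_sub_eq_one {a b : Fin k} :
    |label a - label b| = 1 ↔ (a : ℕ) = b + 1 ∨ (b : ℕ) = a + 1 := by
  rw [abs_eq zero_le_one, label, label]
  constructor
  · rintro (h | h)
    · left; exact_mod_cast (by linarith : ((a : ℕ) : ℝ) = (b : ℕ) + 1)
    · right; exact_mod_cast (by linarith : ((b : ℕ) : ℝ) = (a : ℕ) + 1)
  · rintro (h | h)
    · left; rw [h]; push_cast; ring
    · right; rw [h]; push_cast; ring

/-- The edge-boundary counts the jumps of the characteristic function. -/
lemma ncard_edgeBoundary (A : Set (Fin n → Fin k)) :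
    ((edgeBoundary A).ncard : ℝ) = ∑ i, dirVar i (A.indicator fun _ => (1 : ℝ)) := by
  classical
  -- A boundary edge is encoded by its direction and its lower endpoint. Points on the top face are
  -- excluded automatically, `up` fixing their coordinate.
  let P : Finset (Fin n × (Fin n → Fin k)) :=
    univ.filter fun p => ¬(update p.2 p.1 (up (p.2 p.1)) ∈ A ↔ p.2 ∈ A)
  let F : Fin n × (Fin n → Fin k) → Sym2 (Fin n → Fin k) :=
    fun p => s(p.2, update p.2 p.1 (up (p.2 p.1)))
  have hP : ∀ {i x}, (i, x) ∈ P ↔ ¬(update x i (up (x i)) ∈ A ↔ x ∈ A) := by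
    intro i x; simp [P]
  have hup : ∀ {i x}, (i, x) ∈ P → (up (x i) : ℕ) = x i + 1 := by
    intro i x h
    refine up_val_of_ne fun e => hP.1 h ?_
    rw [e, update_eq_self]
  have himage : edgeBoundary A = F '' P := by
    ext e
    constructor
    · rintro ⟨he, x, hx, y, hy, rfl⟩
      obtain ⟨j, hj, hne⟩ := he
      rcases abs_label_sub_eq_one.1 hj with h | h
      · have e : update x j (up (x j)) = y := by
          rw [up_eq_of_val h]
          funext i
          by_cases hi : i = j
          · subst hi; simp
          · simpa [hi] using hne i hi
        exact ⟨(j, x), hP.2 (by rw [e]; tauto), by simp only [F]; rw [e]⟩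
      · have e : update y j (up (y j)) = x := by
          rw [up_eq_of_val h]
          funext i
          by_cases hi : i = j
          · subst hi; simp
          · simpa [hi] using (hne i hi).symm
        exact ⟨(j, y), hP.2 (by rw [e]; tauto), by simp only [F]; rw [e, Sym2.eq_swap]⟩
    · rintro ⟨⟨i, x⟩, hp, rfl⟩
      have h1 := hup hp
      have h2 := hP.1 hp
      refine ⟨⟨i, abs_label_sub_eq_one.2 (Or.inl (by simpa using h1)), fun j hj => by simp [hj]⟩,
        ?_⟩
      by_cases hx : x ∈ A
      · exact ⟨x, hx, _, by tauto, rfl⟩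
      · exact ⟨update x i (up (x i)), by tauto, x, hx, Sym2.eq_swap⟩
  have hinj : Set.InjOn F P := by
    rintro ⟨i, x⟩ hp ⟨j, y⟩ hq h
    have hi := hup hp
    have hj := hup hq
    rcases Sym2.eq_iff.1 h with ⟨h1, h2⟩ | ⟨h1, h2⟩
    · simp only at h1 h2
      subst h1
      by_cases hij : i = j
      · rw [hij]
      · have := congrArg Fin.val (congrFun h2 i)
        simp [hij] at this
        omega
    · simp only at h1 h2
      have e1 := congrArg Fin.val (congrFun h1 j)
      have e2 := congrArg Fin.val (congrFun h2 j)
      simp only [update_self] at e1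
      by_cases hij : j = i
      · subst hij
        simp only [update_self] at e2
        omega
      · simp only [update_of_ne hij] at e2
        omega
  rw [himage, hinj.ncard_image, Set.ncard_coe_finset]
  simp only [dirVar]
  rw [← Fintype.sum_prod_type' fun i x => |A.indicator (fun _ => (1 : ℝ)) (update x i (up (x i)))
    - A.indicator (fun _ => (1 : ℝ)) x|]
  rw [card_filter]
  push_cast
  refine sum_congr rfl fun p _ => ?_
  by_cases h1 : update p.2 p.1 (up (p.2 p.1)) ∈ A <;> by_cases h2 : p.2 ∈ A <;> simp [h1, h2]

lemma expect_eq_div_pow (F : (Fin n → Fin k) → ℝ) :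
    𝔼 x, F x = (∑ x, F x) / (k : ℝ) ^ n := by
  rw [Fintype.expect_eq_sum_div_card]; simp

lemma norm₁_eq (h : (Fin n → Fin k) → ℝ) : norm₁ h = 𝔼 x, |h x| := by
  rw [expect_eq_div_pow, norm₁, one_div_mul_eq_div]

lemma expect_pathVar (hk : 1 ≤ k) (i : Fin n) (f : (Fin n → Fin k) → ℝ) :
    𝔼 x, pathVar (fun t => f (update x i t)) = dirVar i f / (k : ℝ) ^ (n - 1) := by
  have : Nonempty (Fin k) := ⟨⟨0, hk⟩⟩
  have hk' : (k : ℝ) ≠ 0 := by positivity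
  have h := expect_avg i fun x => |f (update x i (up (x i))) - f x|
  have h1 : ∀ x, avg i (fun x => |f (update x i (up (x i))) - f x|) x
      = pathVar (fun t => f (update x i t)) / k := by
    intro x
    rw [avg, Fintype.expect_eq_sum_div_card]
    simp [pathVar]
  simp only [h1] at h
  rw [← expect_div, div_eq_iff hk', expect_eq_div_pow (fun x => |_|)] at h
  rw [h, dirVar]
  have hpow : (k : ℝ) ^ n = (k : ℝ) ^ (n - 1) * k := by
    rw [← pow_succ, Nat.sub_add_cancel i.pos]
  rw [hpow]
  field_simp

/-- On each line in direction `i`, two values differ by at most the variation along that line. This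
makes `dirVar` an upper bound for the `L¹`-influence. -/
lemma expect_abs_sub_avg_le (hk : 1 ≤ k) (i : Fin n) (f : (Fin n → Fin k) → ℝ) :
    𝔼 x, |f x - avg i f x| ≤ dirVar i f / (k : ℝ) ^ (n - 1) := by
  have : Nonempty (Fin k) := ⟨⟨0, hk⟩⟩
  rw [← expect_pathVar hk]
  refine expect_le_expect fun x _ => ?_
  have e : f x - avg i f x = 𝔼 t, (f x - f (update x i t)) := by
    simp [expect_sub_distrib, avg]
  rw [e]
  refine (abs_expect_le _ _).trans (expect_le univ_nonempty fun t _ => ?_)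
  have := abs_sub_le_pathVar (fun t => f (update x i t)) (x i) t
  simpa using this

end Boundary

/-! ### The junta theorem for subsets of the grid -/

section Junta

variable {k n : ℕ}

/-- For a `{0,1}`-valued function, the variance left after fixing the coordinates of influence
more than `exp (-L)` is at most `7 / L` times the total influence. -/
lemma expect_sub_avgs_sq_le (hk : 1 ≤ k) {f : (Fin n → Fin k) → ℝ} (hf : ∀ x, f x = 0 ∨ f x = 1)
    (L : ℝ) (l : List (Fin n)) (hl : l.Nodup)
    (hsmall : ∀ i ∈ l, dirVar i f / (k : ℝ) ^ (n - 1) ≤ Real.exp (-L)) :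
    L * 𝔼 x, (f x - avgs l f x) ^ 2 ≤ 7 * ((∑ i, dirVar i f) / (k : ℝ) ^ (n - 1)) := by
  have : Nonempty (Fin k) := ⟨⟨0, hk⟩⟩
  obtain ⟨τ, _, w, a, b, hw, hLS, hTV⟩ := exists_logSobolev_form_fin k hk
  have h1 := mul_sq_sub_avgs_le hw hLS L (fun i => dirVar i f / (k : ℝ) ^ (n - 1)) l f
    fun i _ => expect_abs_sub_avg_le hk i f
  -- The `7` is `6` from the energy plus `1` from the squared influences, where `exp (-L)` cancels
  -- `exp L`.
  have h2 : energy w a b f ≤ 6 * ((∑ i, dirVar i f) / (k : ℝ) ^ (n - 1)) := by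
    rw [energy, sum_div, mul_sum]
    refine sum_le_sum fun i _ => ?_
    rw [← expect_pathVar hk, mul_expect]
    exact expect_le_expect fun x _ => hTV (fun t => f (update x i t)) fun t => hf _
  have h3 : (l.map fun i => (dirVar i f / (k : ℝ) ^ (n - 1)) ^ 2).sum
      ≤ Real.exp (-L) * ((∑ i, dirVar i f) / (k : ℝ) ^ (n - 1)) := by
    rw [← List.sum_toFinset _ hl, sum_div, mul_sum]
    have h0 : ∀ i, 0 ≤ dirVar i f / (k : ℝ) ^ (n - 1) := fun i =>
      div_nonneg (dirVar_nonneg i f) (by positivity)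
    refine (sum_le_sum fun i hi => ?_).trans (sum_le_sum_of_subset_of_nonneg (subset_univ _)
      fun i _ _ => mul_nonneg (Real.exp_pos _).le (h0 i))
    rw [pow_two]
    exact mul_le_mul_of_nonneg_right (hsmall i (List.mem_toFinset.1 hi)) (h0 i)
  have h4 := mul_le_mul_of_nonneg_left h3 (Real.exp_pos L).le
  rw [← mul_assoc, ← Real.exp_add, add_neg_cancel, Real.exp_zero, one_mul] at h4
  rw [expect_sub_avgs_sq]
  linarith

/-- The junta theorem for the `ℓ¹`-grid. -/
theorem isGridJuntaConstant : IsGridJuntaConstant 29 := by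
  classical
  intro k n hk hn A ε hε
  have : Nonempty (Fin k) := ⟨⟨0, hk⟩⟩
  set f : (Fin n → Fin k) → ℝ := A.indicator fun _ => (1 : ℝ) with hfdef
  have hf : ∀ x, f x = 0 ∨ f x = 1 := fun x => by
    by_cases hx : x ∈ A <;> simp [f, hx]
  rcases le_or_gt 1 ε with hε1 | hε1
  · refine ⟨0, ∅, ⟨∅, rfl, by simp [DependsOn]⟩, ?_, by simpa using (Real.exp_pos _).le⟩
    rw [IsClose, norm₁_eq]
    refine (expect_le univ_nonempty fun x _ => ?_).trans hε1
    rcases hf x with h | h <;> simp [h]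
  have hk0 : (0 : ℝ) < (k : ℝ) ^ (n - 1) := by positivity
  set I : ℝ := (∑ i, dirVar i f) / (k : ℝ) ^ (n - 1) with hI
  have I0 : 0 ≤ I := div_nonneg (sum_nonneg fun i _ => dirVar_nonneg i f) hk0.le
  -- Here `28 = 4 * 7`, the `4` being lost in rounding. The extra `1` in `29` absorbs the factor
  -- `I`, using `ε < 1`.
  obtain ⟨L, L0, hL1, hL2⟩ : ∃ L : ℝ, 0 < L ∧ 28 * I ≤ L * ε ∧
      I * Real.exp L ≤ Real.exp (29 * (I / ε)) := by
    rcases I0.eq_or_lt with h | h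
    · exact ⟨1, one_pos, by rw [← h]; linarith, by rw [← h]; simp⟩
    · refine ⟨28 * (I / ε), by positivity, le_of_eq (by field_simp), ?_⟩
      have h1 : I ≤ I / ε := by rw [le_div_iff₀ hε]; nlinarith
      have h2 : I ≤ Real.exp (I / ε) := by linarith [Real.add_one_le_exp (I / ε)]
      calc I * Real.exp (28 * (I / ε)) ≤ Real.exp (I / ε) * Real.exp (28 * (I / ε)) :=
            mul_le_mul_of_nonneg_right h2 (Real.exp_pos _).le
        _ = _ := by rw [← Real.exp_add]; ring_nf
  let J : Finset (Fin n) :=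
    univ.filter fun i => Real.exp (-L) < dirVar i f / (k : ℝ) ^ (n - 1)
  let h := avgs (univ \ J).toList f
  let B : Set (Fin n → Fin k) := {x | 1 / 2 ≤ h x}
  have hV := expect_sub_avgs_sq_le hk hf L (univ \ J).toList (nodup_toList _) fun i hi => by
    simpa [J] using hi
  rw [← hI] at hV
  have hdep : DependsOn h (J : Set (Fin n)) :=
    dependsOn_of_update fun i hi => avgs_update (by simpa using hi) f
  refine ⟨J.card, B, ⟨J, rfl, fun x y hxy => ?_⟩, ?_, ?_⟩
  · simp only [Set.indicator, B, Set.mem_ofPred_eq, hdep hxy]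
  · rw [IsClose, norm₁_eq]
    -- Where rounding errs, `h` is at distance at least `1 / 2` from `f`.
    have hpt : ∀ x, |f x - B.indicator (fun _ => (1 : ℝ)) x| ≤ 4 * (f x - h x) ^ 2 := by
      intro x
      by_cases hB : x ∈ B
      · have hB' : 1 / 2 ≤ h x := hB
        rcases hf x with e | e
        · simp only [e, Set.indicator_of_mem hB]; norm_num; nlinarith
        · simp only [e, Set.indicator_of_mem hB]; norm_num; positivity
      · have hB' : h x < 1 / 2 := not_le.1 hB
        rcases hf x with e | e
        · simp only [e, Set.indicator_of_notMem hB]; norm_num; positivity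
        · simp only [e, Set.indicator_of_notMem hB]; norm_num; nlinarith
    refine (expect_le_expect fun x _ => hpt x).trans ?_
    rw [← mul_expect]
    have : L * (4 * 𝔼 x, (f x - h x) ^ 2) ≤ L * ε := by
      have : L * 𝔼 x, (f x - h x) ^ 2 ≤ 7 * I := hV
      linarith
    exact le_of_mul_le_mul_left this L0
  · have e : 29 * ((edgeBoundary A).ncard : ℝ) / ((k : ℝ) ^ (n - 1) * ε) = 29 * (I / ε) := by
      rw [ncard_edgeBoundary, ← hfdef, hI]; field_simp
    rw [e]
    refine le_trans ?_ hL2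
    -- Each coordinate in `J` contributes more than `exp (-L)` to the total influence.
    have h1 : (J.card : ℝ) * Real.exp (-L) ≤ I := by
      rw [← nsmul_eq_mul, hI, sum_div]
      refine (card_nsmul_le_sum J _ _ fun i hi => (mem_filter.1 hi).2.le).trans
        (sum_le_sum_of_subset_of_nonneg (subset_univ _) fun i _ _ =>
          div_nonneg (dirVar_nonneg i f) hk0.le)
    rw [Real.exp_neg, ← div_eq_mul_inv, div_le_iff₀ (Real.exp_pos L)] at h1
    exact h1

end Junta

/-! ### From level sets to Lipschitz maps -/

section Lipschitz

variable {k l n m : ℕ}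

/-- A constant in the junta theorem is nonnegative: a dictator on two points is not close to a
constant function. -/
lemma IsGridJuntaConstant.nonneg {C : ℝ} (hC : IsGridJuntaConstant C) : 0 ≤ C := by
  by_contra! hneg
  set A : Set (Fin 1 → Fin 2) := {x | x 0 = 0} with hA
  obtain ⟨M, B, ⟨J, hJ, hB⟩, hclose, hM⟩ := hC 2 1 (by norm_num) le_rfl A (1 / 4) (by norm_num)
  have hmem : s(fun _ => 0, fun _ => 1) ∈ edgeBoundary A := by
    refine ⟨⟨0, by simp [label], fun i hi => absurd (Subsingleton.elim i 0) hi⟩,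
      fun _ => 0, rfl, fun _ => 1, by simp [hA], rfl⟩
  have hpos : 0 < (edgeBoundary A).ncard := (Set.ncard_pos (Set.toFinite _)).2 ⟨_, hmem⟩
  have hpos' : (0 : ℝ) < (edgeBoundary A).ncard := by exact_mod_cast hpos
  have h1 : C * ((edgeBoundary A).ncard : ℝ) / (((2 : ℕ) : ℝ) ^ (1 - 1) * (1 / 4)) < 0 :=
    div_neg_of_neg_of_pos (mul_neg_of_neg_of_pos hneg hpos') (by norm_num)
  have h2 : (M : ℝ) < 1 := hM.trans_lt (Real.exp_lt_one_iff.2 h1)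
  have h3 : M = 0 := by
    have : M < 1 := by exact_mod_cast h2
    omega
  subst h3
  rw [card_eq_zero] at hJ
  subst hJ
  have hconst := hB (x := fun _ => (0 : Fin 2)) (y := fun _ => 1) (by simp)
  rw [IsClose, norm₁_eq, Fintype.expect_eq_sum_div_card,
    ← (Equiv.funUnique (Fin 1) (Fin 2)).symm.sum_comp] at hclose
  have e0 : (Equiv.funUnique (Fin 1) (Fin 2)).symm 0 = fun _ => 0 := rfl
  have e1 : (Equiv.funUnique (Fin 1) (Fin 2)).symm 1 = fun _ => 1 := rfl
  have a0 : A.indicator (fun _ => (1 : ℝ)) (fun _ => 0) = 1 := by simp [hA]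
  have a1 : A.indicator (fun _ => (1 : ℝ)) (fun _ => 1) = 0 := by simp [hA]
  rw [Fin.sum_univ_two, e0, e1, a0, a1, hconst] at hclose
  set b := B.indicator (fun _ => (1 : ℝ)) (fun _ => (1 : Fin 2))
  have h4 : (1 : ℝ) ≤ |1 - b| + |0 - b| := by
    have := abs_sub (1 - b) (0 - b)
    have e : 1 - b - (0 - b) = 1 := by ring
    rw [e, abs_one] at this
    exact this
  simp at hclose h4
  linarith

lemma sum_range_ite_lt {p N : ℕ} (h : p ≤ N) :
    ∑ t ∈ range N, (if t < p then (1 : ℝ) else 0) = p := by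
  rw [← sum_filter]
  have : (range N).filter (fun t => t < p) = range p := by
    ext t; simp only [mem_filter, mem_range]; omega
  simp [this]

lemma sum_range_abs_ite_sub {p q N : ℕ} (hp : p ≤ N) (hq : q ≤ N) :
    ∑ t ∈ range N, |(if t < p then (1 : ℝ) else 0) - (if t < q then 1 else 0)|
      = |(p : ℝ) - q| := by
  wlog h : q ≤ p generalizing p q
  · rw [abs_sub_comm, ← this hq hp (by omega)]
    exact sum_congr rfl fun t _ => abs_sub_comm _ _
  rw [← sum_range_ite_lt hp, ← sum_range_ite_lt hq, ← sum_sub_distrib,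
    abs_of_nonneg (sum_nonneg fun t _ => by split_ifs <;> first | omega | norm_num)]
  refine sum_congr rfl fun t _ => abs_of_nonneg ?_
  split_ifs <;> first | omega | norm_num

/-- The level sets of a function with values in `[l]`. -/
def levelSet (F : (Fin n → Fin k) → Fin l) (t : ℕ) : Set (Fin n → Fin k) := {x | t < (F x : ℕ)}

lemma indicator_levelSet (F : (Fin n → Fin k) → Fin l) (t : ℕ) (x : Fin n → Fin k) :
    (levelSet F t).indicator (fun _ => (1 : ℝ)) x = if t < (F x : ℕ) then 1 else 0 := by
  classical
  simp [Set.indicator_apply, levelSet]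

/-- A discrete coarea formula. -/
lemma sum_ncard_edgeBoundary_levelSet (F : (Fin n → Fin k) → Fin l) :
    ∑ t ∈ range (l - 1), ((edgeBoundary (levelSet F t)).ncard : ℝ)
      = ∑ j, dirVar j fun x => label (F x) := by
  simp only [ncard_edgeBoundary]
  rw [sum_comm]
  refine sum_congr rfl fun j _ => ?_
  simp only [dirVar]
  rw [sum_comm]
  refine sum_congr rfl fun x _ => ?_
  simp only [indicator_levelSet]
  rw [sum_range_abs_ite_sub (Nat.le_sub_one_of_lt (F _).2) (Nat.le_sub_one_of_lt (F _).2)]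
  simp [label]

/-- A function with values in `[l]` and small total variation is close to a junta. -/
lemma exists_dependsOn_isClose {C : ℝ} (hC : IsGridJuntaConstant C) (hk : 1 ≤ k) (hl : 1 ≤ l)
    (hn : 1 ≤ n) {ε E : ℝ} (hε : 0 < ε) (hE : 0 ≤ E) (F : (Fin n → Fin k) → Fin l)
    (hF : ∑ j, dirVar j (fun x => label (F x)) ≤ E) :
    ∃ (J : Finset (Fin n)) (g : (Fin n → Fin k) → Fin l), DependsOn g (J : Set (Fin n)) ∧
      IsClose ε (fun x => label (F x)) (fun x => label (g x)) ∧
      (J.card : ℝ) ≤ ((l : ℝ) - 1) * Real.exp (2 * C * E / ((k : ℝ) ^ (n - 1) * ε)) := by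
  classical
  have hC0 := hC.nonneg
  have hk0 : (0 : ℝ) < (k : ℝ) ^ (n - 1) := by positivity
  have hl0 : (0 : ℝ) < l := by positivity
  let D : ℕ → ℝ := fun t => ((edgeBoundary (levelSet F t)).ncard : ℝ)
  have hD0 : ∀ t, 0 ≤ D t := fun t => Nat.cast_nonneg _
  have hDE : ∑ t ∈ range (l - 1), D t ≤ E := (sum_ncard_edgeBoundary_levelSet F).trans_le hF
  -- The error budget is split in proportion to the boundary, which makes the exponent independent
  -- of `t` at the cost of a factor `2`. The summand `1 / l` keeps `η t` positive when `D t` or `E`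
  -- vanishes.
  let η : ℕ → ℝ := fun t => ε / 2 * (D t / E + 1 / l)
  have hη : ∀ t, 0 < η t := fun t => by
    have := div_nonneg (hD0 t) hE
    positivity
  have hηsum : ∑ t ∈ range (l - 1), η t ≤ ε := by
    have h1 : ∑ t ∈ range (l - 1), D t / E ≤ 1 := by
      rw [← sum_div]; exact div_le_one_of_le₀ hDE hE
    have h2 : ∑ t ∈ range (l - 1), 1 / (l : ℝ) ≤ 1 := by
      rw [sum_const, card_range, nsmul_eq_mul, mul_one_div]
      exact div_le_one_of_le₀ (by exact_mod_cast Nat.sub_le l 1) hl0.le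
    rw [← mul_sum, sum_add_distrib]
    nlinarith
  choose M B hJunta hclose hM using fun t => hC k n hk hn (levelSet F t) (η t) (hη t)
  choose J hJcard hJ using hJunta
  have hexp : ∀ t ∈ range (l - 1), C * D t / ((k : ℝ) ^ (n - 1) * η t)
      ≤ 2 * C * E / ((k : ℝ) ^ (n - 1) * ε) := by
    intro t ht
    rcases (hD0 t).eq_or_lt with h | h
    · rw [← h, mul_zero, zero_div]; positivity
    · have hE' : 0 < E := h.trans_le ((single_le_sum (fun t _ => hD0 t) ht).trans hDE)
      have h1 : ε / 2 * (D t / E) ≤ η t :=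
        mul_le_mul_of_nonneg_left (by linarith [one_div_pos.2 hl0]) (by positivity)
      calc _ ≤ C * D t / ((k : ℝ) ^ (n - 1) * (ε / 2 * (D t / E))) := by gcongr
        _ = _ := by field_simp
  -- The junta counts the sets `B t` containing `x`; they need not be nested.
  have hg : ∀ x, ∑ t ∈ range (l - 1), (if x ∈ B t then 1 else 0) < l := fun x =>
    calc _ ≤ ∑ t ∈ range (l - 1), 1 := sum_le_sum fun t _ => by split_ifs <;> simp
      _ < l := by simp; omega
  refine ⟨(range (l - 1)).biUnion J,
    fun x => ⟨∑ t ∈ range (l - 1), (if x ∈ B t then 1 else 0), hg x⟩, ?_, ?_, ?_⟩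
  · intro x y hxy
    refine Fin.ext ?_
    simp only
    refine sum_congr rfl fun t ht => ?_
    have h := hJ t (x := x) (y := y) fun i hi =>
      hxy i (mem_coe.2 (mem_biUnion.2 ⟨t, ht, mem_coe.1 hi⟩))
    by_cases hx : x ∈ B t <;> by_cases hy : y ∈ B t <;> simp [hx, hy] at h ⊢
  · have hpt : ∀ x, |label (F x) - label (⟨∑ t ∈ range (l - 1), (if x ∈ B t then 1 else 0),
          hg x⟩ : Fin l)| ≤ ∑ t ∈ range (l - 1),
        |(levelSet F t).indicator (fun _ => (1 : ℝ)) x - (B t).indicator (fun _ => (1 : ℝ)) x| := by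
      intro x
      refine le_trans (le_of_eq ?_) (abs_sum_le_sum_abs _ _)
      rw [sum_sub_distrib]
      simp only [indicator_levelSet, sum_range_ite_lt (Nat.le_sub_one_of_lt (F x).2), label]
      simp only [Set.indicator_apply]
      push_cast
      congr 1
      ring
    rw [IsClose, norm₁_eq]
    refine (expect_le_expect fun x _ => hpt x).trans ?_
    rw [expect_sum_comm]
    refine le_trans (sum_le_sum fun t _ => ?_) hηsum
    have := hclose t
    rwa [IsClose, norm₁_eq] at this
  · calc ((((range (l - 1)).biUnion J).card : ℕ) : ℝ) ≤ ∑ t ∈ range (l - 1), ((J t).card : ℝ) := by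
          exact_mod_cast card_biUnion_le
      _ ≤ ∑ t ∈ range (l - 1), Real.exp (2 * C * E / ((k : ℝ) ^ (n - 1) * ε)) :=
          sum_le_sum fun t ht => by
            rw [hJcard]
            exact (hM t).trans (Real.exp_le_exp.2 (hexp t ht))
      _ = _ := by rw [sum_const, card_range, nsmul_eq_mul, Nat.cast_sub hl, Nat.cast_one]

lemma abs_label_up_sub_le (a : Fin k) : |label (up a) - label a| ≤ 1 := by
  by_cases h : up a = a
  · simp [h]
  · exact (abs_label_sub_eq_one.2 (Or.inl (up_val_of_ne h))).le

lemma dist₁_update_up_le (x : Fin n → Fin k) (j : Fin n) :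
    dist₁ (update x j (up (x j))) x ≤ 1 / n := by
  rw [dist₁]
  refine mul_le_of_le_one_right (by positivity) ?_
  rw [Fintype.sum_eq_single j fun i hi => by simp [hi]]
  simpa using abs_label_up_sub_le (x j)

/-- The total variation of a Lipschitz map, summed over the coordinates of the target. -/
lemma IsLipschitz.sum_dirVar_le {α : ℝ} (hα : 0 ≤ α) {f : (Fin n → Fin k) → (Fin m → Fin l)}
    (hf : IsLipschitz α f) (hn : 1 ≤ n) (hm : 1 ≤ m) :
    ∑ i, ∑ j, dirVar j (fun x => label (f x i)) ≤ m * (α * (k : ℝ) ^ n) := by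
  have n0 : (0 : ℝ) < n := by positivity
  have m0 : (0 : ℝ) < m := by positivity
  have hedge : ∀ j x, ∑ i, |label (f (update x j (up (x j))) i) - label (f x i)|
      ≤ m * (α * (1 / n)) := by
    intro j x
    have h := (hf (update x j (up (x j))) x).trans
      (mul_le_mul_of_nonneg_left (dist₁_update_up_le x j) hα)
    rw [dist₁, one_div_mul_eq_div, div_le_iff₀ m0] at h
    linarith
  rw [sum_comm]
  calc ∑ j, ∑ i, dirVar j (fun x => label (f x i))
      = ∑ j, ∑ x, ∑ i, |label (f (update x j (up (x j))) i) - label (f x i)| :=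
        sum_congr rfl fun j _ => sum_comm
    _ ≤ ∑ _j : Fin n, ∑ _x : Fin n → Fin k, m * (α * (1 / n)) :=
        sum_le_sum fun j _ => sum_le_sum fun x _ => hedge j x
    _ = m * (α * (k : ℝ) ^ n) := by
        simp only [sum_const, card_univ, Fintype.card_fin, Fintype.card_pi, prod_const,
          nsmul_eq_mul]
        push_cast
        field_simp

/-- A map with a negative Lipschitz constant has a one-point domain. -/
lemma IsLipschitz.card_le_one {α : ℝ} (hα : α < 0) {f : (Fin n → Fin k) → (Fin m → Fin l)}
    (hf : IsLipschitz α f) (hn : 1 ≤ n) : k ≤ 1 := by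
  by_contra! hk
  have h := hf (fun _ => ⟨1, hk⟩) fun _ => ⟨0, by omega⟩
  have h1 : dist₁ (fun _ : Fin n => (⟨1, hk⟩ : Fin k)) (fun _ => ⟨0, by omega⟩) = 1 := by
    have : (n : ℝ) ≠ 0 := by positivity
    simp [dist₁, label, this]
  have h2 : 0 ≤ dist₁ (f fun _ => ⟨1, hk⟩) (f fun _ => ⟨0, by omega⟩) :=
    mul_nonneg (by positivity) (sum_nonneg fun _ _ => abs_nonneg _)
  rw [h1] at h
  linarith

/-- Markov's inequality for finite sums. -/
lemma le_card_filter_le {ι : Type*} [Fintype ι] {v : ι → ℝ} (hv : ∀ i, 0 ≤ v i) {S δ : ℝ}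
    (hS : 0 ≤ S) (hδ : 0 < δ) (h : ∑ i, v i ≤ Fintype.card ι * S) :
    (1 - δ) * Fintype.card ι ≤ ((univ.filter fun i => v i ≤ S / δ).card : ℝ) := by
  have hcard : ((univ.filter fun i => v i ≤ S / δ).card : ℝ)
      + ((univ.filter fun i => ¬ v i ≤ S / δ).card : ℝ) = Fintype.card ι := by
    exact_mod_cast card_filter_add_card_filter_not (s := univ) fun i => v i ≤ S / δ
  have hbad : ((univ.filter fun i => ¬ v i ≤ S / δ).card : ℝ) ≤ δ * Fintype.card ι := by
    rcases hS.eq_or_lt with h0 | h0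
    · have hz : ∀ i, v i ≤ S / δ := fun i => by
        rw [← h0, mul_zero] at h
        rw [← h0, zero_div]
        exact (single_le_sum (fun i _ => hv i) (mem_univ i)).trans h
      simp only [hz, not_true_eq_false, filter_false, card_empty, Nat.cast_zero]
      positivity
    · have h1 : ((univ.filter fun i => ¬ v i ≤ S / δ).card : ℝ) * (S / δ) ≤ ∑ i, v i := by
        rw [← nsmul_eq_mul]
        exact (card_nsmul_le_sum _ _ _ fun i hi => (not_le.1 (mem_filter.1 hi).2).le).trans
          (sum_le_sum_of_subset_of_nonneg (subset_univ _) fun i _ _ => hv i)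
      have h2 := h1.trans h
      rw [mul_div_assoc', div_le_iff₀ hδ] at h2
      refine le_of_mul_le_mul_right ?_ h0
      linarith
  linarith

/-- Most coordinates of a Lipschitz map between grids are close to juntas. -/
theorem IsGridJuntaConstant.exists_junta_of_isLipschitz {C : ℝ} (hC : IsGridJuntaConstant C)
    (hk : 1 ≤ k) (hl : 1 ≤ l) (hn : 1 ≤ n) (hm : 1 ≤ m) {α : ℝ}
    {f : (Fin n → Fin k) → (Fin m → Fin l)} (hf : IsLipschitz α f) {δ ε : ℝ} (hδ : 0 < δ)
    (hε : 0 < ε) :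
    ∃ M : ℕ, (M : ℝ) ≤ ((l : ℝ) - 1) * Real.exp (2 * C * α * k / (δ * ε)) ∧
      (1 - δ) * (m : ℝ) ≤
        ({i : Fin m | ∃ g : (Fin n → Fin k) → Fin l, IsJunta M g ∧
          IsClose ε (fun x => label (f x i)) (fun x => label (g x))}.ncard : ℝ) := by
  have hl1 : (0 : ℝ) ≤ (l : ℝ) - 1 := by
    have : (1 : ℝ) ≤ l := by exact_mod_cast hl
    linarith
  rcases lt_or_ge α 0 with hα | hα
  · obtain rfl : k = 1 := le_antisymm (hf.card_le_one hα hn) hk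
    refine ⟨0, by simpa using mul_nonneg hl1 (Real.exp_pos _).le, ?_⟩
    have huniv : {i : Fin m | ∃ g : (Fin n → Fin 1) → Fin l, IsJunta 0 g ∧
        IsClose ε (fun x => label (f x i)) (fun x => label (g x))} = Set.univ := by
      refine Set.eq_univ_of_forall fun i => ⟨fun x => f x i, ⟨∅, rfl, fun x y _ => ?_⟩, ?_⟩
      · rw [Subsingleton.elim x y]
      · simpa [IsClose, norm₁] using hε.le
    rw [huniv, Set.ncard_univ, Nat.card_fin]
    have : (0 : ℝ) ≤ m := Nat.cast_nonneg m
    nlinarith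
  set R : ℝ := ((l : ℝ) - 1) * Real.exp (2 * C * α * k / (δ * ε)) with hR
  have hR0 : 0 ≤ R := mul_nonneg hl1 (Real.exp_pos _).le
  -- One `M` must serve all good coordinates with exactly `M` variables, so smaller sets are padded;
  -- the cap `n` makes this possible.
  refine ⟨min n ⌊R⌋₊, ?_, ?_⟩
  · exact le_trans (by exact_mod_cast min_le_right _ _) (Nat.floor_le hR0)
  set v : Fin m → ℝ := fun i => ∑ j, dirVar j fun x => label (f x i)
  have hmarkov := le_card_filter_le (v := v) (S := α * (k : ℝ) ^ n)
    (fun i => sum_nonneg fun j _ => dirVar_nonneg j _) (by positivity) hδ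
    (by simpa using hf.sum_dirVar_le hα hn hm)
  rw [Fintype.card_fin] at hmarkov
  refine hmarkov.trans ?_
  rw [← Set.ncard_coe_finset]
  refine Nat.cast_le.2 (Set.ncard_le_ncard (fun i hi => ?_) (Set.toFinite _))
  have hi' : v i ≤ α * (k : ℝ) ^ n / δ := by simpa using hi
  obtain ⟨J, g, hg, hclose, hJ⟩ := exists_dependsOn_isClose hC hk hl hn hε
    (by positivity) (fun x => f x i) hi'
  have hexp : 2 * C * (α * (k : ℝ) ^ n / δ) / ((k : ℝ) ^ (n - 1) * ε)
      = 2 * C * α * k / (δ * ε) := by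
    have hpow : (k : ℝ) ^ n = (k : ℝ) ^ (n - 1) * k := by rw [← pow_succ, Nat.sub_add_cancel hn]
    have hk0 : (k : ℝ) ≠ 0 := by positivity
    rw [hpow]
    field_simp
  rw [hexp, ← hR] at hJ
  have hcard : J.card ≤ min n ⌊R⌋₊ :=
    le_min (by simpa using card_le_univ J) (Nat.le_floor hJ)
  obtain ⟨J', hJJ', hJ'⟩ := exists_superset_card_eq hcard (by simp)
  exact ⟨g, ⟨J', hJ', hg.mono (coe_subset.2 hJJ')⟩, hclose⟩

end Lipschitz

end L1Grid

theorem theorem1p9 :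
    (∃ C₃ : ℝ, 0 < C₃ ∧
      ∀ (k l n m : ℕ), 1 ≤ k → 1 ≤ l → 1 ≤ n → 1 ≤ m →
      ∀ (α : ℝ) (f : (Fin n → Fin k) → (Fin m → Fin l)), L1Grid.IsLipschitz α f →
      ∀ (δ ε : ℝ), 0 < δ → 0 < ε →
      ∃ M : ℕ, (M : ℝ) ≤ ((l : ℝ) - 1) * Real.exp (C₃ * α * k / (δ * ε)) ∧
        (1 - δ) * (m : ℝ) ≤
          ({i : Fin m | ∃ g : (Fin n → Fin k) → Fin l, L1Grid.IsJunta M g ∧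
            L1Grid.IsClose ε (fun x => L1Grid.label (f x i))
              (fun x => L1Grid.label (g x))}.ncard : ℝ)) ∧
    (∀ C₁ : ℝ, L1Grid.IsGridJuntaConstant C₁ →
      ∀ (k l n m : ℕ), 1 ≤ k → 1 ≤ l → 1 ≤ n → 1 ≤ m →
      ∀ (α : ℝ) (f : (Fin n → Fin k) → (Fin m → Fin l)), L1Grid.IsLipschitz α f →
      ∀ (δ ε : ℝ), 0 < δ → 0 < ε →
      ∃ M : ℕ, (M : ℝ) ≤ ((l : ℝ) - 1) * Real.exp ((2 * C₁) * α * k / (δ * ε)) ∧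
        (1 - δ) * (m : ℝ) ≤
          ({i : Fin m | ∃ g : (Fin n → Fin k) → Fin l, L1Grid.IsJunta M g ∧
            L1Grid.IsClose ε (fun x => L1Grid.label (f x i))
              (fun x => L1Grid.label (g x))}.ncard : ℝ)) := by
  refine ⟨⟨2 * 29, by norm_num, ?_⟩, ?_⟩
  · intro k l n m hk hl hn hm α f hf δ ε hδ hε
    exact L1Grid.isGridJuntaConstant.exists_junta_of_isLipschitz hk hl hn hm hf hδ hε
  · intro C₁ hC k l n m hk hl hn hm α f hf δ ε hδ hε
    exact hC.exists_junta_of_isLipschitz hk hl hn hm hf hδ hε
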